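/- Let $G$ be a finite simple graph and let $s \ge 1$ be an integer. In the hat guessing game on $G$ with $k$ colors, an adversary places on each vertex $v$ a hat with a color from $\{1,\dots,k\}$ (an arbitrary assignment, not necessarily a proper coloring). The player at $v$ sees exactly the hats of the neighbors of $v$ and, as a function of these alone, deterministically guesses $s$ colors (repetitions allowed); the functions are fixed in advance. The players win with $k$ colors if there are such guessing functions for which, for every hat assignment, at least one player has the color of his own hat among his guesses. Let $\mathrm{HG}_s(G)$ be the maximum $k$ such that the players win with $k$ colors (and $\mathrm{HG}_s(G)=0$ if $G$ has no vertices). A petal graph is a graph obtained from a (possibly empty) path $P$ by adding one new vertex adjacent to every vertex of $P$. A block of $G$ is a maximal connected subgraph of $G$ that has no cut-vertex of its own. The graph $G$ is a petunia if every block of $G$ is isomorphic to a subgraph of a petal graph. **Theorem.** If $G$ is a petunia, then for every integer $s \ge 1$, $$\mathrm{HG}_s(G) \le (3s^2+3s+3)^{3(s^2+s+1)^2}.$$ -/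

import Mathlib

/-- A guessing strategy for the players sitting at the vertices of `G`, with hat colors `Fin k`:
each player, seeing only the hats of the neighbors, names a finite set of colors. -/
def HatStrategy {V : Type*} (G : SimpleGraph V) (k : ℕ) : Type _ :=
  (v : V) → (G.neighborSet v → Fin k) → Finset (Fin k)

/-- The players on `G` have a strategy with at most `s` guesses per player that guarantees, for
every assignment of hats with `k` colors, that at least one player guesses the own color. -/
def HatGameWon {V : Type*} (G : SimpleGraph V) (s k : ℕ) : Prop :=
  ∃ Γ : HatStrategy G k,
    (∀ v x, (Γ v x).card ≤ s) ∧
    ∀ c : V → Fin k, ∃ v, c v ∈ Γ v (fun w => c w)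

/-- The hat guessing number with `s` guesses per player: the largest number `k` of colors for which
the players have a winning strategy. It is taken as a supremum in `ℕ∞`, so that an upper bound
by a natural number really bounds every such `k`. -/
noncomputable def hatGuessingNumber {V : Type*} (G : SimpleGraph V) (s : ℕ) : ℕ∞ :=
  sSup {m : ℕ∞ | ∃ k : ℕ, m = k ∧ HatGameWon G s k}

/-- The petal graph whose path has `n` vertices: the stem `none` is adjacent to every vertex of
the path `some 0, …, some (n - 1)`; the path may be empty. -/
def petalGraph (n : ℕ) : SimpleGraph (Option (Fin n)) where
  Adj
    | none, none => False
    | none, some _ => True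
    | some _, none => True
    | some i, some j => (SimpleGraph.pathGraph n).Adj i j
  symm := ⟨by
    rintro (_ | i) (_ | j) h
    · exact h
    · trivial
    · trivial
    · exact SimpleGraph.Adj.symm h⟩
  loopless := ⟨by
    rintro (_ | i) h
    · exact h
    · exact SimpleGraph.irrefl _ h⟩

/-- A connected subgraph without a cut-vertex: deleting any one of its vertices leaves a
connected (or empty) graph. -/
def IsConnectedWithoutCutVertex {V : Type*} {G : SimpleGraph V} (H : G.Subgraph) : Prop :=
  H.Connected ∧ ∀ v ∈ H.verts, (H.deleteVerts {v}).Preconnected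

/-- A block of `G`: a maximal connected subgraph of `G` without a cut-vertex of its own. -/
def IsGraphBlock {V : Type*} {G : SimpleGraph V} (H : G.Subgraph) : Prop :=
  Maximal IsConnectedWithoutCutVertex H

/-- A petunia: every block is (isomorphic to) a subgraph of a petal graph. -/
def IsPetunia {V : Type*} (G : SimpleGraph V) : Prop :=
  ∀ H : G.Subgraph, IsGraphBlock H → ∃ n : ℕ, H.coe.IsContained (petalGraph n)

/-! The adversary plays with a root: for any `s + 1` root colors he wants colorings in which every
player but the root is wrong and the root's neighbors look the same. The root then names the same at
most `s` colors throughout and misses one of the `s + 1`.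

This rooted form glues at a cut vertex with no loss in `s` or in the number of colors
(`IsSeparationAt.isRootEvadable`), so by induction on the vertex set only pieces without a cut
vertex matter. In a petunia these embed in petal graphs. There, deleting a vertex replaces `s`
guesses by `(s + 1) * s`; deleting the root and then the stem leaves a subgraph of a path, which is
peeled from one end. The result is polynomial in `s`, well below the stated bound. -/

open Classical in
/-- The guesses `g` form a strategy, with at most `s` guesses per player, for the hat guessing game
on the subgraph of `G` induced by `W`. Guesses are functions of colorings of all vertices. -/
structure IsStrategyOn {V K : Type*} (G : SimpleGraph V) (s : ℕ) (W : Set V)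
    (g : V → (V → K) → Finset K) : Prop where
  congr : ∀ v ∈ W, ∀ c c' : V → K, (∀ w ∈ W, G.Adj v w → c w = c' w) → g v c = g v c'
  card_le : ∀ v ∈ W, ∀ c, (g v c).card ≤ s

/-- Against each strategy on `W` the adversary has, for every `s + 1` colors of the root `r`,
colorings extending these colors that agree on the neighbors of `r` and make all guesses
outside `r` wrong. -/
def IsRootEvadable {V : Type*} (K : Type*) (G : SimpleGraph V) (s : ℕ) (W : Set V) (r : V) :
    Prop :=
  ∀ g : V → (V → K) → Finset K, IsStrategyOn G s W g → ∀ A : Finset K, A.card = s + 1 →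
    ∃ x : K → V → K, (∀ a ∈ A, x a r = a ∧ ∀ v ∈ W, v ≠ r → x a v ∉ g v (x a)) ∧
      ∀ a ∈ A, ∀ b ∈ A, ∀ w ∈ W, G.Adj r w → x a w = x b w

/-- The adversary beats every strategy on `W` with at most `s` guesses per player. -/
def IsEvadable {V : Type*} (K : Type*) (G : SimpleGraph V) (s : ℕ) (W : Set V) : Prop :=
  ∀ g : V → (V → K) → Finset K, IsStrategyOn G s W g → ∃ x : V → K, ∀ v ∈ W, x v ∉ g v x

/-! ### Rooted evasion, vertex deletion and leaves -/

section Evasion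

variable {V K : Type*} {G : SimpleGraph V} {s : ℕ}

/-- Among any `s + 1` colors of the root, one extends to a coloring making all guesses wrong. -/
theorem IsRootEvadable.exists_mem {W : Set V} {r : V} (h : IsRootEvadable K G s W r) (hr : r ∈ W)
    {g : V → (V → K) → Finset K} (hg : IsStrategyOn G s W g) {A : Finset K}
    (hA : A.card = s + 1) : ∃ x : V → K, x r ∈ A ∧ ∀ v ∈ W, x v ∉ g v x := by
  obtain ⟨x, hx, hagree⟩ := h g hg A hA
  obtain ⟨b, hb⟩ : A.Nonempty := Finset.card_pos.1 (by omega)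
  obtain ⟨a, ha, hab⟩ : ∃ a ∈ A, a ∉ g r (x b) :=
    Finset.exists_mem_notMem_of_card_lt_card (by have := hg.card_le r hr (x b); omega)
  refine ⟨x a, by rw [(hx a ha).1]; exact ha, fun v hv => ?_⟩
  by_cases hvr : v = r
  · subst hvr
    rw [(hx a ha).1, hg.congr v hv (x a) (x b) (hagree a ha b hb)]
    exact hab
  · exact (hx a ha).2 v hv hvr

theorem IsRootEvadable.isEvadable [Fintype K] {W : Set V} {r : V} (h : IsRootEvadable K G s W r)
    (hr : r ∈ W) (hK : s < Fintype.card K) : IsEvadable K G s W := by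
  intro g hg
  obtain ⟨A, -, hA⟩ := Finset.exists_subset_card_eq (s := (Finset.univ : Finset K))
    (n := s + 1) (by rw [Finset.card_univ]; omega)
  obtain ⟨x, -, hx⟩ := h.exists_mem hr hg hA
  exact ⟨x, hx⟩

theorem IsStrategyOn.mono_guesses {t : ℕ} (hst : s ≤ t) {W : Set V}
    {g : V → (V → K) → Finset K} (hg : IsStrategyOn G s W g) : IsStrategyOn G t W g :=
  ⟨hg.congr, fun v hv c => (hg.card_le v hv c).trans hst⟩

theorem IsEvadable.anti_guesses {t : ℕ} (hst : s ≤ t) {W : Set V} (h : IsEvadable K G t W) :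
    IsEvadable K G s W :=
  fun g hg => h g (hg.mono_guesses hst)

open Classical in
/-- Letting all players guess for each of the colors in `A` at `r` simultaneously, with `r` itself
not guessing, gives a strategy on the set without `r`. -/
theorem IsStrategyOn.biUnion_update {W W' : Set V} {r : V} (hW : W ⊆ insert r W') (hr : r ∉ W')
    (hW' : W' ⊆ W) {g : V → (V → K) → Finset K} (hg : IsStrategyOn G s W g) {m : ℕ} {A : Finset K}
    (hA : A.card ≤ m) :
    IsStrategyOn G (m * s) W' fun v c => A.biUnion fun a => g v (Function.update c r a) where
  congr v hv c c' hc := by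
    refine Finset.biUnion_congr rfl fun a _ => hg.congr v (hW' hv) _ _ fun w hw hvw => ?_
    rcases hW hw with rfl | hw'
    · simp
    · have : w ≠ r := fun h => hr (h ▸ hw')
      simp [this, hc w hw' hvw]
  card_le v hv c :=
    (Finset.card_biUnion_le_card_mul _ _ s fun a _ => hg.card_le v (hW' hv) _).trans
      (Nat.mul_le_mul_right s hA)

open Classical in
/-- Coloring everything but the root once for all `s + 1` colors of the root. -/
theorem IsEvadable.isRootEvadable {W : Set V} {r : V}
    (h : IsEvadable K G ((s + 1) * s) (W \ {r})) : IsRootEvadable K G s W r := by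
  intro g hg A hA
  obtain ⟨x, hx⟩ := h _ (hg.biUnion_update (r := r) (by intro w; simp; tauto) (by simp)
    Set.sdiff_subset hA.le)
  refine ⟨fun a => Function.update x r a, fun a ha => ⟨by simp, fun v hv hvr => ?_⟩,
    fun a _ b _ w _ hw => ?_⟩
  · have := hx v ⟨hv, hvr⟩
    simp only [Finset.mem_biUnion, not_exists, not_and] at this
    simpa [hvr] using this a ha
  · simp [hw.ne']

/-- Deleting one vertex at the cost of more guesses. -/
theorem IsEvadable.of_diff_singleton [Fintype K] {W : Set V} {r : V}
    (h : IsEvadable K G ((s + 1) * s) (W \ {r})) (hr : r ∈ W) (hK : s < Fintype.card K) :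
    IsEvadable K G s W :=
  h.isRootEvadable.isEvadable hr hK

open Classical in
/-- Attaching a new root that has at most the old root as neighbor. -/
theorem IsRootEvadable.insert_leaf [Fintype K] {W : Set V} {r r' : V}
    (h : IsRootEvadable K G s W r') (hr' : r' ∈ W) (hr : r ∉ W)
    (hadj : ∀ w ∈ W, G.Adj r w → w = r') (hK : (s + 1) * s < Fintype.card K) :
    IsRootEvadable K G s (insert r W) r := by
  intro g hg A hA
  -- `B a` holds the colors of `r'` that do not extend when `r` has color `a`. Rooted evasion at
  -- `r'` allows at most `s` of them, so some color `b` of `r'` serves all `s + 1` colors of `r`.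
  let B : K → Finset K := fun a => Finset.univ.filter fun b =>
    ¬ ∃ x : V → K, x r = a ∧ x r' = b ∧ ∀ v ∈ W, x v ∉ g v x
  have hB : ∀ a ∈ A, (B a).card ≤ s := by
    intro a _
    by_contra! hlt
    obtain ⟨C, hCB, hC⟩ := Finset.exists_subset_card_eq (show s + 1 ≤ (B a).card from hlt)
    have hg' : IsStrategyOn G s W fun v c => g v (Function.update c r a) := by
      have := hg.biUnion_update (r := r) (W' := W) subset_rfl hr (Set.subset_insert _ _)
        (Finset.card_singleton a).le
      simpa using this
    obtain ⟨x, hxC, hx⟩ := h.exists_mem hr' hg' hC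
    refine (Finset.mem_filter.1 (hCB hxC)).2 ⟨Function.update x r a, by simp, ?_, fun v hv => ?_⟩
    · simp [show r' ≠ r from fun e => hr (e ▸ hr')]
    · simpa [show v ≠ r from fun e => hr (e ▸ hv)] using hx v hv
  obtain ⟨b, -, hb⟩ : ∃ b ∈ (Finset.univ : Finset K), b ∉ A.biUnion B := by
    apply Finset.exists_mem_notMem_of_card_lt_card
    rw [Finset.card_univ]
    exact (Finset.card_biUnion_le_card_mul _ _ s hB).trans_lt (hA ▸ hK)
  have hx : ∀ a, ∃ x : V → K, a ∈ A → x r = a ∧ x r' = b ∧ ∀ v ∈ W, x v ∉ g v x := by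
    intro a
    by_cases ha : a ∈ A
    · have : b ∉ B a := fun hba => hb (Finset.mem_biUnion.2 ⟨a, ha, hba⟩)
      obtain ⟨x, hx⟩ : ∃ x : V → K, x r = a ∧ x r' = b ∧ ∀ v ∈ W, x v ∉ g v x := by
        by_contra hne
        exact this (Finset.mem_filter.2 ⟨Finset.mem_univ _, hne⟩)
      exact ⟨x, fun _ => hx⟩
    · exact ⟨fun _ => b, fun h => absurd h ha⟩
  choose x hx using hx
  refine ⟨x, fun a ha => ⟨(hx a ha).1, fun v hv hvr => ?_⟩, fun a ha a' ha' w hw hrw => ?_⟩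
  · exact (hx a ha).2.2 v (hv.resolve_left hvr)
  · rw [hadj w (hw.resolve_left hrw.ne') hrw, (hx a ha).2.1, (hx a' ha').2.1]

/-! ### Gluing at a cut vertex -/

/-- `W` is the union of `W₁` and `W₂`, which share only `v` and have no edges between them
avoiding `v`. -/
structure IsSeparationAt (G : SimpleGraph V) (W W₁ W₂ : Set V) (v : V) : Prop where
  union_eq : W₁ ∪ W₂ = W
  mem_left : v ∈ W₁
  mem_right : v ∈ W₂
  eq_of_mem : ∀ w ∈ W₁, w ∈ W₂ → w = v
  not_adj : ∀ a ∈ W₁, ∀ b ∈ W₂, a ≠ v → b ≠ v → ¬ G.Adj a b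

namespace IsSeparationAt

variable {W W₁ W₂ : Set V} {v : V}

theorem symm (h : IsSeparationAt G W W₁ W₂ v) : IsSeparationAt G W W₂ W₁ v where
  union_eq := by rw [Set.union_comm, h.union_eq]
  mem_left := h.mem_right
  mem_right := h.mem_left
  eq_of_mem w h₁ h₂ := h.eq_of_mem w h₂ h₁
  not_adj a ha b hb hav hbv hab := h.not_adj b hb a ha hbv hav hab.symm

theorem left_subset (h : IsSeparationAt G W W₁ W₂ v) : W₁ ⊆ W :=
  h.union_eq ▸ Set.subset_union_left

theorem mem_left_of_adj (h : IsSeparationAt G W W₁ W₂ v) {u w : V} (hu : u ∈ W₁) (huv : u ≠ v)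
    (hw : w ∈ W) (huw : G.Adj u w) : w ∈ W₁ := by
  rcases (h.union_eq ▸ hw : w ∈ W₁ ∪ W₂) with hw | hw
  · exact hw
  · by_cases hwv : w = v
    · exact hwv ▸ h.mem_left
    · exact absurd huw (h.not_adj u hu w hw huv hwv)

/-- Once the color of `v` is fixed, the two sides do not interact, so their colorings can be pasted.
-/
theorem isRootEvadable_self (h : IsSeparationAt G W W₁ W₂ v)
    (h₁ : IsRootEvadable K G s W₁ v) (h₂ : IsRootEvadable K G s W₂ v) :
    IsRootEvadable K G s W v := by
  classical
  intro g hg A hA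
  have key : ∀ U₁ U₂ : Set V, IsSeparationAt G W U₁ U₂ v → IsRootEvadable K G s U₁ v →
      ∃ x : K → V → K, (∀ a ∈ A, x a v = a ∧ ∀ u ∈ U₁, u ≠ v → x a u ∉ g u (x a)) ∧
        ∀ a ∈ A, ∀ b ∈ A, ∀ w ∈ U₁, G.Adj v w → x a w = x b w := by
    intro U₁ U₂ hU hE
    -- The player at `v` may see both sides, so his guesses need not form a strategy on `U₁`.
    -- Nothing is required of the root, so he is silenced.
    obtain ⟨x, hx, hagree⟩ := hE (fun u c => if u = v then ∅ else g u c)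
      ⟨fun u hu c c' hc => by
        by_cases huv : u = v
        · simp [huv]
        · simp only [huv, if_false]
          exact hg.congr u (hU.left_subset hu) c c' fun w hw huw =>
            hc w (hU.mem_left_of_adj hu huv hw huw) huw,
      fun u hu c => by
        by_cases huv : u = v
        · simp [huv]
        · simp only [huv, if_false]
          exact hg.card_le u (hU.left_subset hu) c⟩ A hA
    refine ⟨x, fun a ha => ⟨(hx a ha).1, fun u hu huv => ?_⟩, hagree⟩
    simpa [huv] using (hx a ha).2 u hu huv
  obtain ⟨x, hx, hxa⟩ := key W₁ W₂ h h₁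
  obtain ⟨y, hy, hya⟩ := key W₂ W₁ h.symm h₂
  let z : K → V → K := fun a w => if w ∈ W₁ then x a w else y a w
  have hz₁ : ∀ a, ∀ w ∈ W₁, z a w = x a w := fun a w hw => by simp [z, hw]
  have hz₂ : ∀ a ∈ A, ∀ w ∈ W₂, z a w = y a w := fun a ha w hw => by
    by_cases hw₁ : w ∈ W₁
    · rw [hz₁ a w hw₁, h.eq_of_mem w hw₁ hw, (hx a ha).1, (hy a ha).1]
    · simp [z, hw₁]
  refine ⟨z, fun a ha => ⟨by rw [hz₁ a v h.mem_left, (hx a ha).1], fun u hu huv => ?_⟩,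
    fun a ha b hb w hw hvw => ?_⟩
  · rcases (h.union_eq ▸ hu : u ∈ W₁ ∪ W₂) with hu₁ | hu₂
    · rw [hz₁ a u hu₁, hg.congr u hu (z a) (x a) fun w hw huw =>
        hz₁ a w (h.mem_left_of_adj hu₁ huv hw huw)]
      exact (hx a ha).2 u hu₁ huv
    · rw [hz₂ a ha u hu₂, hg.congr u hu (z a) (y a) fun w hw huw =>
        hz₂ a ha w (h.symm.mem_left_of_adj hu₂ huv hw huw)]
      exact (hy a ha).2 u hu₂ huv
  · rcases (h.union_eq ▸ hw : w ∈ W₁ ∪ W₂) with hw | hw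
    · rw [hz₁ a w hw, hz₁ b w hw, hxa a ha b hb w hw hvw]
    · rw [hz₂ a ha w hw, hz₂ b hb w hw, hya a ha b hb w hw hvw]

/-- For each coloring of the neighbors of `v` in `W₁`, at most `s` colors of `v` fail to extend over
`W₂`. Taking these as the guesses of `v` encodes all of `W₂` in a game on `W₁`. -/
theorem isRootEvadable_of_ne [Fintype K] {r : V} (h : IsSeparationAt G W W₁ W₂ v)
    (h₁ : IsRootEvadable K G s W₁ r) (h₂ : IsRootEvadable K G s W₂ v) (hr : r ∈ W₁)
    (hrv : r ≠ v) : IsRootEvadable K G s W r := by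
  classical
  intro g hg A hA
  let B : (V → K) → Finset K := fun c => Finset.univ.filter fun a =>
    ¬ ∃ y : V → K, y v = a ∧ (∀ w ∈ W₁, G.Adj v w → y w = c w) ∧ ∀ u ∈ W₂, y u ∉ g u y
  have hB : ∀ c, (B c).card ≤ s := by
    intro c
    by_contra! hlt
    obtain ⟨C, hCB, hC⟩ := Finset.exists_subset_card_eq (show s + 1 ≤ (B c).card from hlt)
    -- Freezing `c` outside `W₂` makes `g` a strategy on `W₂` alone.
    let e : (V → K) → V → K := fun y w => if w ∈ W₂ then y w else c w
    have hg' : IsStrategyOn G s W₂ fun u y => g u (e y) :=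
      ⟨fun u hu y y' hy => hg.congr u (h.symm.left_subset hu) _ _ fun w _ huw => by
        by_cases hw : w ∈ W₂
        · simp [e, hw, hy w hw huw]
        · simp [e, hw],
      fun u hu y => hg.card_le u (h.symm.left_subset hu) _⟩
    obtain ⟨y, hyC, hy⟩ := h₂.exists_mem h.mem_right hg' hC
    refine (Finset.mem_filter.1 (hCB hyC)).2 ⟨e y, by simp [e, h.mem_right], ?_, fun u hu => ?_⟩
    · intro w hw hvw
      have : w ∉ W₂ := fun hw₂ => hvw.ne' (h.eq_of_mem w hw hw₂)
      simp [e, this]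
    · simpa [e, hu] using hy u hu
  obtain ⟨x, hx, hagree⟩ := h₁ (fun u c => if u = v then B c else g u c)
    ⟨fun u hu c c' hc => by
      by_cases huv : u = v
      · subst huv
        simp only [if_true, B]
        refine Finset.filter_congr fun a _ => not_congr (exists_congr fun y => ?_)
        refine and_congr_right fun _ => and_congr_left fun _ => ?_
        exact forall₃_congr fun w hw hvw => by rw [hc w hw hvw]
      · simp only [huv, if_false]
        exact hg.congr u (h.left_subset hu) c c' fun w hw huw =>
          hc w (h.mem_left_of_adj hu huv hw huw) huw,
    fun u hu c => by
      by_cases huv : u = v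
      · simpa [huv] using hB c
      · simpa [huv] using hg.card_le u (h.left_subset hu) c⟩ A hA
  have hy : ∀ a, ∃ y : V → K, a ∈ A → y v = x a v ∧
      (∀ w ∈ W₁, G.Adj v w → y w = x a w) ∧ ∀ u ∈ W₂, y u ∉ g u y := by
    intro a
    by_cases ha : a ∈ A
    · have hv := (hx a ha).2 v h.mem_left hrv.symm
      simp only [if_true, B, Finset.mem_filter, Finset.mem_univ, true_and, not_not] at hv
      obtain ⟨y, hy⟩ := hv
      exact ⟨y, fun _ => hy⟩
    · exact ⟨x a, fun h => absurd h ha⟩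
  choose y hy using hy
  let z : K → V → K := fun a w => if w ∈ W₂ then y a w else x a w
  have hz₂ : ∀ a, ∀ w ∈ W₂, z a w = y a w := fun a w hw => by simp [z, hw]
  have hz₁ : ∀ a ∈ A, ∀ w ∈ W₁, z a w = x a w := fun a ha w hw => by
    by_cases hw₂ : w ∈ W₂
    · rw [hz₂ a w hw₂, h.eq_of_mem w hw hw₂, (hy a ha).1]
    · simp [z, hw₂]
  refine ⟨z, fun a ha => ⟨by rw [hz₁ a ha r hr, (hx a ha).1], fun u hu hur => ?_⟩,
    fun a ha b hb w hw hrw => ?_⟩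
  · by_cases hu₂ : u ∈ W₂
    · rw [hz₂ a u hu₂, hg.congr u hu (z a) (y a) fun w hw huw => ?_]
      · exact (hy a ha).2.2 u hu₂
      · by_cases hw₂ : w ∈ W₂
        · exact hz₂ a w hw₂
        · have hw₁ : w ∈ W₁ := (h.union_eq ▸ hw : w ∈ W₁ ∪ W₂).resolve_right hw₂
          -- Only `v` sees past `W₂`, and `y a` was chosen to match `x a` on what he sees there.
          obtain rfl : u = v := by
            by_contra huv
            exact hw₂ (h.symm.mem_left_of_adj hu₂ huv hw huw)
          rw [hz₁ a ha w hw₁, (hy a ha).2.1 w hw₁ huw]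
    · have hu₁ : u ∈ W₁ := (h.union_eq ▸ hu : u ∈ W₁ ∪ W₂).resolve_right hu₂
      have huv : u ≠ v := fun e => hu₂ (e ▸ h.mem_right)
      rw [hz₁ a ha u hu₁, hg.congr u hu (z a) (x a) fun w hw huw =>
        hz₁ a ha w (h.mem_left_of_adj hu₁ huv hw huw)]
      simpa [huv] using (hx a ha).2 u hu₁ hur
  · have hw₁ := h.mem_left_of_adj hr hrv hw hrw
    rw [hz₁ a ha w hw₁, hz₁ b hb w hw₁, hagree a ha b hb w hw₁ hrw]

/-- Rooted evasion passes from both sides of a separation to the whole. -/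
theorem isRootEvadable [Fintype K] {r : V} (h : IsSeparationAt G W W₁ W₂ v)
    (h₁ : ∀ u ∈ W₁, IsRootEvadable K G s W₁ u) (h₂ : ∀ u ∈ W₂, IsRootEvadable K G s W₂ u)
    (hr : r ∈ W) : IsRootEvadable K G s W r := by
  by_cases hrv : r = v
  · subst hrv
    exact h.isRootEvadable_self (h₁ r h.mem_left) (h₂ r h.mem_right)
  · rcases (h.union_eq ▸ hr : r ∈ W₁ ∪ W₂) with hr | hr
    · exact h.isRootEvadable_of_ne (h₁ r hr) (h₂ v h.mem_right) hr hrv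
    · exact h.symm.isRootEvadable_of_ne (h₂ r hr) (h₁ v h.mem_left) hr hrv

end IsSeparationAt

/-! ### Paths and petal graphs -/

/-- Subgraphs of paths: the function `f` places the vertices of `W` on a path. -/
theorem isEvadable_of_path [Fintype K] [Finite V] {W : Set V} (f : V → ℕ) (hf : Set.InjOn f W)
    (hadj : ∀ u ∈ W, ∀ w ∈ W, G.Adj u w → f u = f w + 1 ∨ f w = f u + 1)
    (hK : (s + 1) * s < Fintype.card K) : IsEvadable K G s W := by
  have hs : s < Fintype.card K := lt_of_le_of_lt (Nat.le_mul_of_pos_left s s.succ_pos) hK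
  have key : ∀ n, ∀ W : Set V, W.ncard = n → Set.InjOn f W →
      (∀ u ∈ W, ∀ w ∈ W, G.Adj u w → f u = f w + 1 ∨ f w = f u + 1) →
      ∀ r ∈ W, (∀ w ∈ W, f w ≤ f r) → IsRootEvadable K G s W r := by
    intro n
    induction n with
    | zero =>
      intro W hW _ _ r hr
      rw [Set.ncard_eq_zero] at hW
      simp [hW] at hr
    | succ n ih =>
      intro W hW hf hadj r hr hmax
      have hsub : W \ {r} ⊆ W := Set.sdiff_subset
      rcases (W \ {r}).eq_empty_or_nonempty with hemp | hne
      · apply IsEvadable.isRootEvadable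
        rw [hemp]
        have : Nonempty K := Fintype.card_pos_iff.1 (by omega)
        exact fun _ _ => ⟨fun _ => Classical.arbitrary K, by simp⟩
      · obtain ⟨r', hr', hmax'⟩ := Set.exists_max_image _ f (Set.toFinite (W \ {r})) hne
        have h' := ih (W \ {r}) (by rw [Set.ncard_sdiff_singleton_of_mem hr, hW]; rfl)
          (hf.mono hsub) (fun u hu w hw => hadj u (hsub hu) w (hsub hw)) r' hr' hmax'
        have := h'.insert_leaf (r := r) hr' (by simp) (fun w hw hrw => ?_) hK
        · rwa [Set.insert_sdiff_singleton, Set.insert_eq_of_mem hr] at this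
        · have h₁ := hadj r hr w hw.1 hrw
          have h₂ := hmax w hw.1
          have h₃ := hmax' w hw
          have h₄ := hmax r' hr'.1
          have h₅ : f r' ≠ f r := fun e => hr'.2 (hf hr'.1 hr e)
          exact hf hw.1 hr'.1 (by omega)
  rcases W.eq_empty_or_nonempty with rfl | hne
  · have : Nonempty K := Fintype.card_pos_iff.1 (by omega)
    exact fun _ _ => ⟨fun _ => Classical.arbitrary K, by simp⟩
  · obtain ⟨r, hr, hmax⟩ := Set.exists_max_image W f (Set.toFinite W) hne
    exact (key _ W rfl hf hadj r hr hmax).isEvadable hr hs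

/-- Subgraphs of petal graphs. -/
theorem isEvadable_of_petal [Fintype K] [Finite V] {W : Set V} {n : ℕ} (f : V → Option (Fin n))
    (hf : Set.InjOn f W) (hadj : ∀ u ∈ W, ∀ w ∈ W, G.Adj u w → (petalGraph n).Adj (f u) (f w))
    (hK : ((s + 1) * s + 1) * ((s + 1) * s) < Fintype.card K) : IsEvadable K G s W := by
  have hle : s ≤ (s + 1) * s := Nat.le_mul_of_pos_left s s.succ_pos
  have hs : s < Fintype.card K :=
    (hle.trans (Nat.le_mul_of_pos_left _ (Nat.succ_pos _))).trans_lt hK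
  have key : ∀ U ⊆ W, (∀ u ∈ U, f u ≠ none) → IsEvadable K G ((s + 1) * s) U := by
    intro U hU hnone
    refine isEvadable_of_path (fun v => (f v).elim 0 fun i => (i : ℕ)) ?_ ?_ hK
    · intro u hu w hw huw
      obtain ⟨i, hi⟩ := Option.ne_none_iff_exists'.1 (hnone u hu)
      obtain ⟨j, hj⟩ := Option.ne_none_iff_exists'.1 (hnone w hw)
      refine hf (hU hu) (hU hw) ?_
      simp only [hi, hj, Option.elim_some] at huw ⊢
      rw [Fin.ext huw]
    · intro u hu w hw huw
      obtain ⟨i, hi⟩ := Option.ne_none_iff_exists'.1 (hnone u hu)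
      obtain ⟨j, hj⟩ := Option.ne_none_iff_exists'.1 (hnone w hw)
      have h := hadj u (hU hu) w (hU hw) huw
      rw [hi, hj] at h
      have h' : (SimpleGraph.pathGraph n).Adj i j := h
      rw [SimpleGraph.pathGraph_adj] at h'
      simp only [hi, hj, Option.elim_some]
      omega
  by_cases h : ∃ r ∈ W, f r = none
  · obtain ⟨r, hr, hrn⟩ := h
    refine IsEvadable.of_diff_singleton (r := r) (key _ Set.sdiff_subset ?_) hr hs
    intro u hu hun
    exact hu.2 (hf hu.1 hr (hun.trans hrn.symm))
  · push Not at h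
    exact (key W subset_rfl h).anti_guesses hle

/-! ### Reduction to pieces without a cut vertex -/

/-- A set inducing a disconnected graph splits into two parts without edges between them. -/
theorem exists_partition_of_not_preconnected {W : Set V}
    (h : ¬ ((⊤ : G.Subgraph).induce W).Preconnected) :
    ∃ S T : Set V, S ∪ T = W ∧ Disjoint S T ∧ S.Nonempty ∧ T.Nonempty ∧
      ∀ a ∈ S, ∀ b ∈ T, ¬ G.Adj a b := by
  set H := (⊤ : G.Subgraph).induce W with hH
  have hc : ¬ H.coe.Preconnected := fun hc => h ⟨hc⟩
  simp only [SimpleGraph.Preconnected, not_forall] at hc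
  obtain ⟨u, w, huw⟩ := hc
  refine ⟨{a | ∃ ha : a ∈ H.verts, H.coe.Reachable u ⟨a, ha⟩},
    {a | ∃ ha : a ∈ H.verts, ¬ H.coe.Reachable u ⟨a, ha⟩}, ?_, ?_, ⟨u, u.2, .rfl⟩,
    ⟨w, w.2, huw⟩, ?_⟩
  · ext a
    have : a ∈ H.verts ↔ a ∈ W := Iff.rfl
    simp only [Set.mem_union, Set.mem_ofPred_eq]
    rw [← this, ← exists_or]
    exact ⟨fun ⟨ha, _⟩ => ha, fun ha => ⟨ha, em _⟩⟩
  · rw [Set.disjoint_left]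
    rintro a ⟨ha, h₁⟩ ⟨_, h₂⟩
    exact h₂ h₁
  · rintro a ⟨ha, h₁⟩ b ⟨hb, h₂⟩ hab
    refine h₂ (h₁.trans (SimpleGraph.Adj.reachable ?_))
    exact ⟨ha, hb, hab⟩

/-- If the adversary can evade on every vertex set inducing a connected graph without cut-vertex,
then he can evade on every vertex set. -/
theorem isRootEvadable_of_blocks [Fintype K] [Finite V] (hK : (s + 1) * s < Fintype.card K)
    (hG : ∀ W : Set V, IsConnectedWithoutCutVertex ((⊤ : G.Subgraph).induce W) →
      ∀ r ∈ W, IsRootEvadable K G s W r) (W : Set V) :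
    ∀ r ∈ W, IsRootEvadable K G s W r := by
  induction hn : W.ncard using Nat.strong_induction_on generalizing W with
  | _ n ih =>
  subst hn
  have ih' : ∀ U ⊂ W, ∀ r ∈ U, IsRootEvadable K G s U r := fun U hU =>
    ih U.ncard (Set.ncard_lt_ncard hU) U rfl
  intro r hr
  by_cases hcon : ((⊤ : G.Subgraph).induce W).Preconnected
  · by_cases hcut : ∀ v ∈ W, (((⊤ : G.Subgraph).induce W).deleteVerts {v}).Preconnected
    · refine hG W ⟨?_, hcut⟩ r hr
      exact SimpleGraph.Subgraph.connected_iff.2 ⟨hcon, ⟨r, hr⟩⟩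
    · push Not at hcut
      obtain ⟨v, hv, hcut⟩ := hcut
      have hdel : ((⊤ : G.Subgraph).induce W).deleteVerts {v} =
          (⊤ : G.Subgraph).induce (W \ {v}) := by
        ext <;> simp <;> tauto
      rw [hdel] at hcut
      obtain ⟨S, T, hST, hdisj, ⟨a, ha⟩, ⟨b, hb⟩, hadj⟩ := exists_partition_of_not_preconnected hcut
      have hS : ∀ x ∈ S, x ∈ W ∧ x ≠ v := fun x hx => (hST ▸ Or.inl hx : x ∈ W \ {v})
      have hT : ∀ x ∈ T, x ∈ W ∧ x ≠ v := fun x hx => (hST ▸ Or.inr hx : x ∈ W \ {v})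
      have hd : ∀ x ∈ S, x ∉ T := fun _ => (Set.disjoint_left.1 hdisj ·)
      have hsep : IsSeparationAt G W (insert v S) (insert v T) v := by
        refine ⟨?_, by simp, by simp, ?_, ?_⟩
        · rw [← Set.insert_union_distrib, hST, Set.insert_sdiff_singleton, Set.insert_eq_of_mem hv]
        · rintro w (rfl | hw) (hw' | hw')
          · rfl
          · rfl
          · exact hw'
          · exact absurd hw' (hd w hw)
        · rintro x hx y hy hxv hyv
          exact hadj x (hx.resolve_left hxv) y (hy.resolve_left hyv)
      refine hsep.isRootEvadable (ih' _ ⟨hsep.left_subset, fun hsub => ?_⟩)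
        (ih' _ ⟨hsep.symm.left_subset, fun hsub => ?_⟩) hr
      · rcases hsub (hT b hb).1 with h | h
        · exact (hT b hb).2 h
        · exact hd b h hb
      · rcases hsub (hS a ha).1 with h | h
        · exact (hS a ha).2 h
        · exact hd a ha h
  · obtain ⟨S, T, hST, hrS, hdisj, hT, hadj⟩ : ∃ S T : Set V, S ∪ T = W ∧ r ∈ S ∧ Disjoint S T ∧
        T.Nonempty ∧ ∀ a ∈ S, ∀ b ∈ T, ¬ G.Adj a b := by
      obtain ⟨S, T, hST, hdisj, hS, hT, hadj⟩ := exists_partition_of_not_preconnected hcon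
      rcases (hST ▸ hr : r ∈ S ∪ T) with h | h
      · exact ⟨S, T, hST, h, hdisj, hT, hadj⟩
      · exact ⟨T, S, by rw [Set.union_comm, hST], h, hdisj.symm, hS,
          fun a ha b hb hab => hadj b hb a ha hab.symm⟩
    obtain ⟨b, hb⟩ := hT
    have hd : ∀ x ∈ S, x ∉ T := fun _ => (Set.disjoint_left.1 hdisj ·)
    have hSW : S ⊆ W := hST ▸ Set.subset_union_left
    have hTW : T ⊆ W := hST ▸ Set.subset_union_right
    -- If `S = {r}`, then `insert r T` is all of `W` and the induction would not descend; `r` is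
    -- instead attached as an isolated vertex. Otherwise adding `r` to `T` gives a separation at
    -- `r`.
    by_cases hS : S = {r}
    · have := (ih' T ⟨hTW, fun h => hd r hrS (h hr)⟩ b hb).insert_leaf hb (hd r hrS)
        (fun w hw hrw => absurd hrw (hadj r hrS w hw)) hK
      rwa [Set.insert_eq, ← hS, hST] at this
    · have hsep : IsSeparationAt G W S (insert r T) r := by
        refine ⟨?_, hrS, by simp, ?_, ?_⟩
        · rw [Set.union_insert, hST, Set.insert_eq_of_mem hr]
        · rintro w hw (rfl | hw')
          · rfl
          · exact absurd hw' (hd w hw)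
        · exact fun x hx y hy _ hyr => hadj x hx y (hy.resolve_left hyr)
      refine hsep.isRootEvadable (ih' _ ⟨hSW, fun h => hd b (h (hTW hb)) hb⟩)
        (ih' _ ⟨hsep.symm.left_subset, fun h => hS ?_⟩) hr
      refine Set.Subset.antisymm (fun x hx => ?_) (by simpa using hrS)
      exact (h (hSW hx)).resolve_right (hd x hx)

end Evasion

/-! ### Petunias and the numerical bound -/

/-- In a petunia, all connected subgraphs without cut-vertex are subgraphs of petal graphs. -/
theorem IsPetunia.isContained_petalGraph {V : Type*} [Finite V] {G : SimpleGraph V}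
    (hG : IsPetunia G) {H : G.Subgraph} (hH : IsConnectedWithoutCutVertex H) :
    ∃ n : ℕ, H.coe.IsContained (petalGraph n) := by
  obtain ⟨B, hHB, hB⟩ := Finite.exists_le_maximal hH
  obtain ⟨n, hn⟩ := hG B hB
  exact ⟨n, SimpleGraph.IsContained.trans
    ⟨⟨SimpleGraph.Subgraph.inclusion hHB, SimpleGraph.Subgraph.inclusion.injective hHB⟩⟩ hn⟩

/-- Deleting the root raises `s` to `t`, deleting the stem raises `t` to `(t + 1) * t`, and the path
condition for that many guesses is `hK`. -/
theorem IsPetunia.isRootEvadable {V K : Type*} [Finite V] [Fintype K] {G : SimpleGraph V}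
    (hG : IsPetunia G) {s t : ℕ} (ht : t = (s + 1) * s)
    (hK : ((t + 1) * t + 1) * ((t + 1) * t) < Fintype.card K) (W : Set V) :
    ∀ r ∈ W, IsRootEvadable K G s W r := by
  classical
  have h₁ : t ≤ (t + 1) * t := Nat.le_mul_of_pos_left t t.succ_pos
  refine isRootEvadable_of_blocks (ht ▸ (h₁.trans
    (Nat.le_mul_of_pos_left _ (Nat.succ_pos _))).trans_lt hK) ?_ W
  intro W hW r hr
  obtain ⟨n, ⟨φ⟩⟩ := hG.isContained_petalGraph hW
  apply IsEvadable.isRootEvadable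
  rw [← ht]
  let f : V → Option (Fin n) := fun v => if h : v ∈ W then φ ⟨v, h⟩ else none
  have hf : ∀ v (h : v ∈ W), f v = φ ⟨v, h⟩ := fun v h => dif_pos h
  refine isEvadable_of_petal f ?_ ?_ hK
  · intro u hu w hw huw
    rw [hf u hu.1, hf w hw.1] at huw
    exact congrArg Subtype.val (φ.injective huw)
  · intro u hu w hw huw
    rw [hf u hu.1, hf w hw.1]
    exact φ.toHom.map_adj (show ((⊤ : G.Subgraph).induce W).Adj u w from ⟨hu.1, hw.1, huw⟩)

/-- A polynomial bound on the number of colors for which the players win on a petunia. -/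
theorem IsPetunia.le_of_hatGameWon {V : Type*} [Finite V] {G : SimpleGraph V}
    (hG : IsPetunia G) {s t k : ℕ} (ht : t = (s + 1) * s) (h : HatGameWon G s k) :
    k ≤ ((t + 1) * t + 1) * ((t + 1) * t) := by
  by_contra! hk
  obtain ⟨Γ, hΓ, hwin⟩ := h
  have hst : s ≤ t := ht ▸ Nat.le_mul_of_pos_left s s.succ_pos
  have htt : t ≤ (t + 1) * t := Nat.le_mul_of_pos_left t t.succ_pos
  have hsk : s < k := ((hst.trans htt).trans
    (Nat.le_mul_of_pos_left _ (Nat.succ_pos _))).trans_lt hk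
  -- A win against any one coloring supplies a vertex to serve as root.
  obtain ⟨r, -⟩ := hwin fun _ => ⟨0, by omega⟩
  have hev := (hG.isRootEvadable (K := Fin k) ht (by simpa using hk) Set.univ r
    (Set.mem_univ r)).isEvadable (Set.mem_univ r) (by simpa using hsk)
  obtain ⟨c, hc⟩ := hev (fun v c => Γ v fun w => c w)
    ⟨fun v _ c c' hcc => congrArg (Γ v) (funext fun w => hcc w (Set.mem_univ _) w.2),
      fun v _ c => hΓ v _⟩
  obtain ⟨v, hv⟩ := hwin c
  exact hc v (Set.mem_univ v) hv

theorem theorem3p3 {V : Type*} [Finite V] (G : SimpleGraph V) (hG : IsPetunia G)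
    (s : ℕ) (hs : 1 ≤ s) :
    hatGuessingNumber G s ≤
      (((3 * s ^ 2 + 3 * s + 3) ^ (3 * (s ^ 2 + s + 1) ^ 2) : ℕ) : ℕ∞) := by
  refine sSup_le ?_
  rintro _ ⟨k, rfl, hk⟩
  refine Nat.cast_le.2 ((hG.le_of_hatGameWon rfl hk).trans ?_)
  -- With `t + 1 = q`, the polynomial bound is at most `q ^ 4`, while the target is `(3 * q) ^ (3 *
  -- q ^ 2)`.
  set q := s ^ 2 + s + 1 with hq
  have ht : (s + 1) * s + 1 = q := by rw [hq]; ring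
  have hq1 : 1 ≤ q := by omega
  have hq2 : 2 ≤ q := by omega
  rw [ht]
  have h₁ : (s + 1) * s ≤ q := by omega
  have h₂ : q * ((s + 1) * s) + 1 ≤ q ^ 2 := by
    have : q ^ 2 = q * ((s + 1) * s) + q := by rw [← ht]; ring
    omega
  calc (q * ((s + 1) * s) + 1) * (q * ((s + 1) * s)) ≤ q ^ 2 * q ^ 2 :=
        Nat.mul_le_mul h₂ (by omega)
    _ = q ^ 4 := by ring
    _ ≤ (3 * s ^ 2 + 3 * s + 3) ^ 4 := Nat.pow_le_pow_left (by omega) 4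
    _ ≤ (3 * s ^ 2 + 3 * s + 3) ^ (3 * q ^ 2) :=
        Nat.pow_le_pow_right (by omega) (by nlinarith)
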